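/- **Critical edge MSE.** *Network.* Let $\lambda,\lambda_u,b,q>0$ and $0\le\delta_c<\delta_t$ (AP density, device density, uplink bandwidth, payload, cloud compute delay, delay budget). APs form a homogeneous Poisson process of density $\lambda$ in $\mathbb R^2$. The path loss over a link with displacement $x$ is $S\|x\|^4$, with i.i.d. shadowing $S>0$, $\mathbb E[S^{-1/2}]<\infty$; fading gains are i.i.d. $\mathrm{Exp}(1)$. Each device associates with the AP of minimum path loss, and $\nu$ denotes the law of this minimum path loss. Transmit power inverts the path loss, thermal noise is neglected, and the co-channel interferers are modelled, in coordinates centred at the AP serving the typical device, as a Poisson process $\Psi$ of marked points $(x,s,l,h)$ (displacement, shadowing towards this AP, path loss to the own serving AP, fading gain) with intensity $\lambda\,dx\otimes\mathrm{Law}(S)(ds)\otimes\nu(dl)\otimes\mathrm{Exp}(1)(dh)$ restricted to $\{l\le s\|x\|^4\}$. With $H\sim\mathrm{Exp}(1)$ independent of $\Psi$, and the load of the AP equal to its average $\bar L=1+1.28\,\lambda_u/\lambda$, put $$\mathtt{SINR}=\frac{H}{\sum_{(x,s,l,h)\in\Psi} l\,h/(s\|x\|^4)},\qquad \mathtt{Rate}=\frac{b}{\bar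 L}\log_2(1+\mathtt{SINR}).$$ The downlink rate is taken equal to the uplink rate, so the cloud inference delay is $D=\frac{q}{2\mathtt{Rate}}+\frac{q}{2\mathtt{Rate}}+\delta_c$. Let $r_{\min}=\frac{q}{b(\delta_t-\delta_c)}$. *Inference.* Let $(x,y)$ be a random inference input and actual (real) output. An inference model $f$ is a measurable function of $x$ with finite MSE $\mathbb E[(y-f(x))^2]$. Fix a cloud model with MSE $m_c>0$ and a target $m_t\ge m_c$. For an edge model with MSE $m_d\ge m_c$ the average MSE is $$\bar m=\mathbb E[\mathbf 1(D\le\delta_t)\,m_c]+\mathbb E[\mathbf 1(D>\delta_t)\,m_d].$$ *Claim.* Let $C(x)=\sqrt x\arctan\sqrt x$, $T(x)=2^x-1$, $e=\exp(-C(T(\bar L r_{\min})))$, and $$m_{d,\max}=m_c\,\frac{m_t/m_c-e}{1-e}.$$ Then an edge model with MSE $m_d\ge m_c$ satisfies $\bar m\le m_t$ if and only if $m_d\le m_{d,\max}$, and $m_{d,\max}$ is the largest MSE $m_d\geq m_c$ of an edge model for which $\bar m\le m_t$. Moreover, for fixed $m_c$ and $m_t$, $m_{d,\max}\to m_t$ as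 $\bar L r_{\min}\to\infty$. -/

import Mathlib

open MeasureTheory ProbabilityTheory Filter Topology
open scoped ENNReal NNReal

noncomputable section

namespace DistInference

/-! ### Poisson point processes -/

/-- `N` is a Poisson point process on `E` with intensity measure `μ`. A point configuration is
represented by its counting measure, so `N ω A` is the number of points in `A` and
`∫⁻ x, f x ∂(N ω)` is the sum of `f` over the points. -/
structure IsPoissonProcess {Ω E : Type*} [MeasurableSpace Ω] [MeasurableSpace E]
    (N : Ω → Measure E) (μ : Measure E) (P : Measure Ω) : Prop where
  measurable : Measurable N
  count_law : ∀ A : Set E, MeasurableSet A → μ A ≠ ⊤ →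
    HasLaw (fun ω => N ω A)
      ((poissonMeasure (μ A).toNNReal).map (fun n : ℕ => (n : ℝ≥0∞))) P
  count_indep : ∀ (n : ℕ) (A : Fin n → Set E), (∀ i, MeasurableSet (A i)) →
    Pairwise (fun i j => Disjoint (A i) (A j)) →
    iIndepFun (fun i ω => N ω (A i)) P

/-! ### System parameters -/

/-- Deterministic parameters: AP density, device density, uplink bandwidth, cumulative payload
size, cloud compute delay and target delay budget. -/
structure Params where
  lam : ℝ
  lamU : ℝ
  b : ℝ
  q : ℝ
  δc : ℝ
  δt : ℝ
  lam_pos : 0 < lam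
  lamU_pos : 0 < lamU
  b_pos : 0 < b
  q_pos : 0 < q
  δc_nonneg : 0 ≤ δc
  δc_lt_δt : δc < δt

/-- Average load `1 + 1.28 / (lam / lamU)` of the serving AP. -/
def Params.load (S : Params) : ℝ := 1 + 1.28 / (S.lam / S.lamU)

/-- Inference rate: the minimum rate for cloud inference, normalized by the bandwidth. -/
def Params.rmin (S : Params) : ℝ := S.q / (S.b * (S.δt - S.δc))

/-! ### The uplink -/

/-- The plane in which APs and devices live. -/
abbrev Plane : Type := EuclideanSpace ℝ (Fin 2)

/-- Path loss over a link with displacement `x` and shadowing `s`. -/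
def pathLoss (x : Plane) (s : ℝ) : ℝ≥0∞ := ENNReal.ofReal s * ENNReal.ofReal ‖x‖ ^ 4

/-- Intensity of the APs seen from a device, each AP being marked with the shadowing of its link
to the device: density `lam` in the plane, i.i.d. shadowing with law `σ`. -/
def apIntensity (lam : ℝ) (σ : Measure ℝ) : Measure (Plane × ℝ) :=
  (ENNReal.ofReal lam • (volume : Measure Plane)).prod σ

/-- Path loss to the serving AP, i.e. the smallest path loss over all points of the configuration
`φ` of APs. For a counting measure a null set is a set without points, so that the essential
infimum is the infimum over the points (and `⊤` if there are none). -/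
def servingPathLoss (φ : Measure (Plane × ℝ)) : ℝ≥0∞ :=
  essInf (fun p => pathLoss p.1 p.2) φ

/-- An interfering device, as seen from the AP serving the typical device: its displacement from
that AP, the shadowing and the path loss to its own serving AP, and the fading power gain. -/
abbrev Interferer : Type := Plane × ℝ × ℝ≥0∞ × ℝ

/-- Intensity of the interfering devices: density `lam` (one co-channel device per cell),
shadowing with law `σ`, own serving path loss with law `ν`, fading exponential with mean `1`;
only devices whose own serving path loss does not exceed the path loss to the AP of the typical
device are kept, since a device associates with the AP of minimum path loss. -/
def interfererIntensity (lam : ℝ) (σ : Measure ℝ) (ν : Measure ℝ≥0∞) : Measure Interferer :=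
  ((ENNReal.ofReal lam • (volume : Measure Plane)).prod (σ.prod (ν.prod (expMeasure 1)))).restrict
    {p | p.2.2.1 ≤ pathLoss p.1 p.2.1}

/-- The random ingredients of the uplink of the typical device: the marked Poisson process `Φ` of
APs seen from a device, the fading gain `H` of the typical device to its serving AP, and the
marked Poisson process `Ψ` of the interfering devices, whose own serving path losses are
distributed like the serving path loss generated by `Φ`. -/
structure IsUplinkModel {Ω : Type*} [MeasurableSpace Ω] (P : Measure Ω) (lam : ℝ) (σ : Measure ℝ)
    (Φ : Ω → Measure (Plane × ℝ)) (H : Ω → ℝ) (Ψ : Ω → Measure Interferer) : Prop where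
  aps : IsPoissonProcess Φ (apIntensity lam σ) P
  fading : HasLaw H (expMeasure 1) P
  interferers : IsPoissonProcess Ψ
    (interfererIntensity lam σ (P.map (fun ω => servingPathLoss (Φ ω)))) P
  indep : IndepFun H Ψ P

/-- Normalized interference at the serving AP. By full path-loss inversion an interferer with own
serving path loss `l`, fading `h` and path loss `L` to that AP contributes `l * h / L`. -/
def interference (ψ : Measure Interferer) : ℝ≥0∞ :=
  ∫⁻ p, p.2.2.1 * ENNReal.ofReal p.2.2.2 / pathLoss p.1 p.2.1 ∂ψ

/-- Uplink SINR of the typical device; `snr = ⊤` means that thermal noise is neglected. -/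
def sinr (snr : ℝ≥0∞) (h : ℝ) (ψ : Measure Interferer) : ℝ≥0∞ :=
  ENNReal.ofReal h / (snr⁻¹ + interference ψ)

/-- Binary logarithm on `[1, ∞]`. -/
def log2 (x : ℝ≥0∞) : ℝ≥0∞ := x.log.toENNReal / ENNReal.ofReal (Real.log 2)

/-- Uplink rate when the serving AP has the average load. -/
def uplinkRate (S : Params) (s : ℝ≥0∞) : ℝ≥0∞ :=
  ENNReal.ofReal (S.b / S.load) * log2 (1 + s)

/-- Cloud inference delay for given uplink and downlink rates (infinite if a rate vanishes). -/
def cloudDelay (S : Params) (rateU rateD : ℝ≥0∞) : ℝ≥0∞ :=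
  ENNReal.ofReal S.q / (2 * rateU) + ENNReal.ofReal S.q / (2 * rateD) + ENNReal.ofReal S.δc

/-- Cloud inference delay of the typical device: the downlink rate equals the uplink rate and
thermal noise is neglected. -/
def delay {Ω : Type*} (S : Params) (H : Ω → ℝ) (Ψ : Ω → Measure Interferer) (ω : Ω) : ℝ≥0∞ :=
  cloudDelay S (uplinkRate S (sinr ⊤ (H ω) (Ψ ω))) (uplinkRate S (sinr ⊤ (H ω) (Ψ ω)))

/-! ### Inference accuracy -/

/-- `f` is an inference model with finite mean squared error under the law `Q` of the pair
(inference input, actual inference output). -/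
def IsInferenceModel {𝓧 : Type*} [MeasurableSpace 𝓧] (Q : Measure (𝓧 × ℝ)) (f : 𝓧 → ℝ) : Prop :=
  Measurable f ∧ MemLp (fun z : 𝓧 × ℝ => z.2 - f z.1) 2 Q

/-- Mean squared error of an inference model. -/
def mse {𝓧 : Type*} [MeasurableSpace 𝓧] (Q : Measure (𝓧 × ℝ)) (f : 𝓧 → ℝ) : ℝ :=
  ∫ z, (z.2 - f z.1) ^ 2 ∂Q

/-- Average MSE `E[1(D ≤ δt) mc] + E[1(D > δt) md]` of the typical device, when the cloud output
is used if its delay `D` is within the budget and the edge output otherwise. -/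
def avgMSE {Ω : Type*} [MeasurableSpace Ω] (P : Measure Ω) (D : Ω → ℝ≥0∞) (δt mc md : ℝ) : ℝ :=
  (∫ ω, {ω | D ω ≤ ENNReal.ofReal δt}.indicator (fun _ => mc) ω ∂P) +
    ∫ ω, {ω | ENNReal.ofReal δt < D ω}.indicator (fun _ => md) ω ∂P

/-- `C(x) = √x arctan √x`. -/
def C (x : ℝ) : ℝ := √x * Real.arctan √x

/-- `T(x) = 2 ^ x - 1`. -/
def T (x : ℝ) : ℝ := (2 : ℝ) ^ x - 1

/-- Critical edge MSE for cloud MSE `mc`, target MSE `mt` and `t` the product of average load and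
inference rate. -/
def criticalMSE (mc mt t : ℝ) : ℝ :=
  mc * ((mt / mc - Real.exp (-C (T t))) / (1 - Real.exp (-C (T t))))

end DistInference

end

/-! Write `θ = T (load * rmin)`. Unfolding delay, rate and logarithm, the budget is met exactly when
`H ≥ θ I`, with `I` the normalized interference (almost surely, as `H > 0`). Since `H` is
exponential and independent of `I`, this event has probability `E exp(-θ I)`, which the Laplace
functional of the Poisson process (`IsPoissonProcess.laplace`) turns into the exponential of an
explicit integral.

Averaging over an interferer's fading gives `a / (1 + a)` with `a = θ l / (s ‖x‖ ^ 4)`. Integrating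
this over `l ≤ s ‖x‖ ^ 4` in the plane gives `π √(l / s) C(θ)`, so the exponent is `λ π C(θ) E[√l]
E[S^(-1/2)]`. By the void probabilities of the AP process, `√l` is exponential with rate `λ π
E[S^(-1/2)]`. Everything but `C(θ)` cancels, and the budget is met with probability `e = exp(-C(θ))`
(`laplace_interference`, `measureReal_delay_le`).

The average MSE is therefore `e mc + (1 - e) md`, affine and strictly increasing in `md`, and the
critical value solves a linear equation. It is attained because adding a constant to the cloud model
realizes every MSE above `mc`; the limit holds because `C(T(t)) → ∞`. -/

namespace DistInference

/-! ### Laplace functional of a Poisson process -/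

/-- The function `x ↦ exp (-x)` on `[0, ∞]`. -/
noncomputable def expNeg (x : ℝ≥0∞) : ℝ≥0∞ := EReal.exp (-(x : EReal))

lemma expNeg_zero : expNeg 0 = 1 := by simp [expNeg]

lemma expNeg_top : expNeg ⊤ = 0 := by simp [expNeg]

lemma expNeg_ofReal {r : ℝ} (hr : 0 ≤ r) :
    expNeg (ENNReal.ofReal r) = ENNReal.ofReal (Real.exp (-r)) := by
  rw [expNeg, EReal.coe_ennreal_ofReal, max_eq_left hr, ← EReal.coe_neg, EReal.exp_coe]

lemma expNeg_add (a b : ℝ≥0∞) : expNeg (a + b) = expNeg a * expNeg b := by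
  rw [expNeg, EReal.coe_ennreal_add, EReal.neg_add, sub_eq_add_neg, EReal.exp_add]
  · rfl
  · left; simp
  · right; simp

lemma expNeg_sum {ι : Type*} (s : Finset ι) (f : ι → ℝ≥0∞) :
    expNeg (∑ i ∈ s, f i) = ∏ i ∈ s, expNeg (f i) := by
  classical
  induction s using Finset.induction_on with
  | empty => simp [expNeg_zero]
  | insert a s ha ih => rw [Finset.sum_insert ha, Finset.prod_insert ha, expNeg_add, ih]

lemma expNeg_mul_natCast (c : ℝ≥0∞) (n : ℕ) : expNeg (c * n) = expNeg c ^ n := by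
  induction n with
  | zero => simp [expNeg_zero]
  | succ n ih => rw [Nat.cast_succ, mul_add, mul_one, expNeg_add, ih, pow_succ]

lemma continuous_expNeg : Continuous expNeg :=
  ENNReal.continuous_exp.comp (continuous_neg.comp continuous_coe_ennreal_ereal)

@[fun_prop]
lemma measurable_expNeg : Measurable expNeg := continuous_expNeg.measurable

lemma expNeg_anti {a b : ℝ≥0∞} (h : a ≤ b) : expNeg b ≤ expNeg a := by
  apply EReal.exp_monotone
  rw [EReal.neg_le_neg_iff]
  exact_mod_cast h

lemma expNeg_le_one (a : ℝ≥0∞) : expNeg a ≤ 1 := by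
  rw [← expNeg_zero]; exact expNeg_anti zero_le

/-- The exponential series at `m z`, with `z = expNeg c`. The value `c = ⊤` is allowed: then `z =
0`, only the term `n = 0` survives, and the formula gives the void probability. -/
lemma lintegral_expNeg_mul_poissonMeasure (m : ℝ≥0) (c : ℝ≥0∞) :
    ∫⁻ n : ℕ, expNeg (c * n) ∂(poissonMeasure m) = expNeg (m * (1 - expNeg c)) := by
  obtain ⟨z, hz, hz1⟩ : ∃ z : ℝ≥0, expNeg c = z ∧ z ≤ 1 := by
    have h := expNeg_le_one c
    lift expNeg c to ℝ≥0 using ne_top_of_le_ne_top ENNReal.one_ne_top h with z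
    exact ⟨z, rfl, by exact_mod_cast h⟩
  have hz1' : (z : ℝ) ≤ 1 := hz1
  have hR : (m : ℝ≥0∞) * (1 - expNeg c) = ENNReal.ofReal (m * (1 - z)) := by
    rw [hz, ENNReal.ofReal_mul (by positivity), ENNReal.ofReal_coe_nnreal,
      ENNReal.ofReal_sub _ (by positivity), ENNReal.ofReal_one, ENNReal.ofReal_coe_nnreal]
  rw [hR, expNeg_ofReal (r := m * (1 - z)) (mul_nonneg m.2 (by linarith)), lintegral_countable']
  have hs : HasSum (fun n : ℕ => Real.exp (-m) * ((m * z : ℝ) ^ n / (n.factorial : ℝ)))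
      (Real.exp (-m) * Real.exp (m * z)) := by
    rw [Real.exp_eq_exp_ℝ]
    exact (NormedSpace.expSeries_div_hasSum_exp (m * z : ℝ)).mul_left _
  have : Real.exp (-(m * (1 - z) : ℝ)) = Real.exp (-m) * Real.exp (m * z) := by
    rw [← Real.exp_add]; ring_nf
  rw [this, ← hs.tsum_eq, ENNReal.ofReal_tsum_of_nonneg (fun n => by positivity) hs.summable]
  congr 1 with n
  rw [expNeg_mul_natCast, hz, poissonMeasure_singleton, ← ENNReal.ofReal_coe_nnreal,
    ← ENNReal.ofReal_pow (by positivity), ← ENNReal.ofReal_mul (by positivity)]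
  congr 1
  rw [mul_pow]; ring

variable {Ω E : Type*} [MeasurableSpace Ω] [MeasurableSpace E]
  {N : Ω → Measure E} {μ : Measure E} {P : Measure Ω}

namespace IsPoissonProcess

lemma measurable_lintegral (hN : IsPoissonProcess N μ P) {f : E → ℝ≥0∞} (hf : Measurable f) :
    Measurable fun ω => ∫⁻ x, f x ∂(N ω) :=
  (Measure.measurable_lintegral hf).comp hN.measurable

lemma measurable_apply (hN : IsPoissonProcess N μ P) {A : Set E} (hA : MeasurableSet A) :
    Measurable fun ω => N ω A :=
  (Measure.measurable_coe hA).comp hN.measurable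

lemma lintegral_expNeg_mul_apply (hN : IsPoissonProcess N μ P) {A : Set E}
    (hA : MeasurableSet A) (hμA : μ A ≠ ⊤) (c : ℝ≥0∞) :
    ∫⁻ ω, expNeg (c * N ω A) ∂P = expNeg (μ A * (1 - expNeg c)) := by
  have hm : Measurable fun x : ℝ≥0∞ => expNeg (c * x) := by fun_prop
  have h := lintegral_map (μ := P) hm (hN.measurable_apply hA)
  rw [← h, (hN.count_law A hA hμA).map_eq, lintegral_map hm (by fun_prop),
    lintegral_expNeg_mul_poissonMeasure, ENNReal.coe_toNNReal hμA]

/-- Probability that a set of finite intensity contains no point. -/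
lemma measure_apply_eq_zero (hN : IsPoissonProcess N μ P) {A : Set E}
    (hA : MeasurableSet A) (hμA : μ A ≠ ⊤) : P {ω | N ω A = 0} = expNeg (μ A) := by
  -- At `c = ⊤` the integrand is the indicator of the void event, since `⊤ * 0 = 0`.
  have h := hN.lintegral_expNeg_mul_apply hA hμA ⊤
  rw [expNeg_top, tsub_zero, mul_one] at h
  have hm : MeasurableSet {ω | N ω A = 0} := hN.measurable_apply hA (measurableSet_singleton 0)
  rw [← h, ← lintegral_indicator_one hm]
  congr 1 with ω
  by_cases h0 : N ω A = 0
  · rw [Set.indicator_of_mem (by simpa using h0), h0, mul_zero, expNeg_zero, Pi.one_apply]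
  · rw [Set.indicator_of_notMem (by simpa using h0), ENNReal.top_mul h0, expNeg_top]

/-- The integral is a weighted sum of the counts in the fibres of `g`. The fibres are disjoint, so
the counts are independent and the expectation factors into Poisson transforms. -/
lemma laplace_simpleFunc (hN : IsPoissonProcess N μ P) (g : SimpleFunc E ℝ≥0∞)
    (hg : g.FinMeasSupp μ) :
    ∫⁻ ω, expNeg (∫⁻ x, g x ∂(N ω)) ∂P = expNeg (∫⁻ x, (1 - expNeg (g x)) ∂μ) := by
  have hR : ∫⁻ x, (1 - expNeg (g x)) ∂μ =
      ∑ c ∈ g.range, (1 - expNeg c) * μ (g ⁻¹' {c}) := by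
    rw [← SimpleFunc.map_lintegral, ← SimpleFunc.lintegral_eq_lintegral]
    rfl
  let e := g.range.equivFin.symm
  let A : Fin g.range.card → Set E := fun i => g ⁻¹' {(e i : ℝ≥0∞)}
  have hA : ∀ i, MeasurableSet (A i) := fun i => g.measurableSet_fiber _
  have hsum : ∀ F : ℝ≥0∞ → ℝ≥0∞, ∑ c ∈ g.range, F c = ∑ i, F (e i) := fun F => by
    rw [← Finset.sum_coe_sort, ← e.sum_comp]
  have hd : Pairwise fun i j => Disjoint (A i) (A j) := by
    intro i j hij
    refine Disjoint.preimage _ (Set.disjoint_singleton.2 fun h => hij ?_)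
    exact e.injective (Subtype.ext h)
  have hi := (hN.count_indep _ A hA hd).comp (fun i x => expNeg ((e i : ℝ≥0∞) * x))
    (fun i => by fun_prop)
  have hL : ∀ ω, expNeg (∫⁻ x, g x ∂(N ω)) =
      ∏ i, ((fun x => expNeg ((e i : ℝ≥0∞) * x)) ∘ fun ω => N ω (A i)) ω := fun ω => by
    rw [SimpleFunc.lintegral_eq_lintegral, SimpleFunc.lintegral, hsum (fun c => c * N ω (g ⁻¹' {c})),
      expNeg_sum]
    rfl
  rw [lintegral_congr hL, lintegral_prod_eq_prod_lintegral_of_indepFun _ _ hi, hR,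
    hsum (fun c => (1 - expNeg c) * μ (g ⁻¹' {c})), expNeg_sum]
  · refine Finset.prod_congr rfl fun i _ => ?_
    -- The fibre over `0` may have infinite intensity, where `count_law` is silent, but its factor
    -- is `1` on both sides.
    by_cases h0 : (e i : ℝ≥0∞) = 0
    · have := hi.isProbabilityMeasure
      simp [h0, expNeg_zero]
    · rw [mul_comm]
      exact hN.lintegral_expNeg_mul_apply (hA i)
        (SimpleFunc.finMeasSupp_iff.1 hg _ h0).ne _
  · intro i
    exact (show Measurable fun x => expNeg ((e i : ℝ≥0∞) * x) by fun_prop).comp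
      (hN.measurable_apply (hA i))

/-- The Laplace functional of a Poisson point process. -/
theorem laplace [SigmaFinite μ] (hN : IsPoissonProcess N μ P) [IsFiniteMeasure P]
    {f : E → ℝ≥0∞} (hf : Measurable f) :
    ∫⁻ ω, expNeg (∫⁻ x, f x ∂(N ω)) ∂P = expNeg (∫⁻ x, (1 - expNeg (f x)) ∂μ) := by
  -- Cutting off to the spanning sets gives supports of finite intensity and still increases to `f`.
  let g : ℕ → SimpleFunc E ℝ≥0∞ := fun n =>
    (SimpleFunc.eapprox f n).restrict (spanningSets μ n)
  have hS : ∀ n, MeasurableSet (spanningSets μ n) := measurableSet_spanningSets μ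
  have hg_apply : ∀ n x, g n x = (spanningSets μ n).indicator (SimpleFunc.eapprox f n) x :=
    fun n x => SimpleFunc.restrict_apply _ (hS n) x
  have hmono : ∀ x, Monotone fun n => g n x := by
    intro x m n hmn
    simp only [hg_apply]
    refine (Set.indicator_le_indicator (SimpleFunc.monotone_eapprox f hmn x)).trans ?_
    exact Set.indicator_le_indicator_of_subset (monotone_spanningSets μ hmn)
      (fun _ => zero_le) x
  have hlim : ∀ x, Tendsto (fun n => g n x) atTop (𝓝 (f x)) := by
    intro x
    obtain ⟨m, hm⟩ := Set.mem_iUnion.1 ((iUnion_spanningSets μ).symm ▸ Set.mem_univ x)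
    refine (SimpleFunc.tendsto_eapprox hf x).congr' ?_
    filter_upwards [eventually_ge_atTop m] with n hn
    rw [hg_apply, Set.indicator_of_mem (monotone_spanningSets μ hn hm)]
  have hfin : ∀ n, (g n).FinMeasSupp μ := by
    intro n
    refine (measure_mono ?_).trans_lt (measure_spanningSets_lt_top μ n)
    intro x hx
    by_contra hxs
    exact hx ((hg_apply n x).trans (Set.indicator_of_notMem hxs _))
  have hN_lim : ∀ ν : Measure E, Tendsto (fun n => ∫⁻ x, g n x ∂ν) atTop (𝓝 (∫⁻ x, f x ∂ν)) :=
    fun ν => lintegral_tendsto_of_tendsto_of_monotone (fun n => (g n).measurable.aemeasurable)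
      (ae_of_all _ hmono) (ae_of_all _ hlim)
  have hleft : Tendsto (fun n => ∫⁻ ω, expNeg (∫⁻ x, g n x ∂(N ω)) ∂P) atTop
      (𝓝 (∫⁻ ω, expNeg (∫⁻ x, f x ∂(N ω)) ∂P)) := by
    -- The integrands decrease in `n` here, hence domination by `1`; those against `μ` increase.
    refine tendsto_lintegral_of_dominated_convergence (fun _ => 1)
      (fun n => measurable_expNeg.comp (hN.measurable_lintegral (g n).measurable))
      (fun n => ae_of_all _ fun ω => expNeg_le_one _) (by simp) (ae_of_all _ fun ω => ?_)
    exact (continuous_expNeg.tendsto _).comp (hN_lim (N ω))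
  have hright : Tendsto (fun n => ∫⁻ x, (1 - expNeg (g n x)) ∂μ) atTop
      (𝓝 (∫⁻ x, (1 - expNeg (f x)) ∂μ)) := by
    refine lintegral_tendsto_of_tendsto_of_monotone
      (fun n => (measurable_const.sub
        (measurable_expNeg.comp (g n).measurable)).aemeasurable)
      (ae_of_all _ fun x m n hmn => tsub_le_tsub_left (expNeg_anti (hmono x hmn)) _)
      (ae_of_all _ fun x => ?_)
    exact ENNReal.Tendsto.sub tendsto_const_nhds ((continuous_expNeg.tendsto _).comp (hlim x))
      (Or.inl ENNReal.one_ne_top)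
  refine tendsto_nhds_unique hleft ?_
  simp_rw [fun n => hN.laplace_simpleFunc (g n) (hfin n)]
  exact (continuous_expNeg.tendsto _).comp hright

end IsPoissonProcess

end DistInference
namespace DistInference

/-! ### Exponential and planar integrals -/

lemma lintegral_exp_neg_mul_Ioi {a : ℝ} (ha : 0 < a) (c : ℝ) :
    ∫⁻ x in Set.Ioi c, ENNReal.ofReal (Real.exp (-(a * x))) =
      ENNReal.ofReal (Real.exp (-(a * c)) / a) := by
  have h1 := integrableOn_exp_mul_Ioi (neg_lt_zero.2 ha) c
  have h2 := integral_exp_mul_Ioi (neg_lt_zero.2 ha) c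
  simp only [neg_mul] at h1 h2
  rw [← ofReal_integral_eq_lintegral_ofReal h1 (ae_of_all _ fun x => (Real.exp_pos _).le), h2,
    neg_div_neg_eq]

lemma lintegral_expMeasure_one {g : ℝ → ℝ≥0∞} (hg : Measurable g) :
    ∫⁻ x, g x ∂(expMeasure 1) = ∫⁻ x in Set.Ioi 0, ENNReal.ofReal (Real.exp (-x)) * g x := by
  have hd : Measurable (exponentialPDF 1) := (measurable_exponentialPDFReal 1).ennreal_ofReal
  have h : expMeasure 1 = volume.withDensity (exponentialPDF 1) := rfl
  rw [h, lintegral_withDensity_eq_lintegral_mul _ hd hg, ← lintegral_indicator measurableSet_Ioi]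
  refine lintegral_congr_ae ?_
  filter_upwards [Measure.ae_ne volume (0 : ℝ)] with x hx
  rcases lt_or_gt_of_ne hx with h0 | h0
  · rw [Set.indicator_of_notMem (by simpa using h0.le), Pi.mul_apply,
      exponentialPDF_of_neg h0, zero_mul]
  · rw [Set.indicator_of_mem (by simpa using h0), Pi.mul_apply, exponentialPDF_of_nonneg h0.le]
    simp

instance isProbabilityMeasure_expMeasure_one : IsProbabilityMeasure (expMeasure 1) :=
  isProbabilityMeasure_expMeasure one_pos

/-- Applied with `t = θ I`, this turns the coverage probability into a Laplace transform of the
interference; `t = ⊤` covers infinite interference. -/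
lemma expMeasure_one_le_ofReal (t : ℝ≥0∞) :
    expMeasure 1 {h | t ≤ ENNReal.ofReal h} = expNeg t := by
  induction t using ENNReal.recTopCoe with
  | top => simp [expNeg_top]
  | coe t =>
  have hm : MeasurableSet {h : ℝ | (t : ℝ≥0∞) ≤ ENNReal.ofReal h} :=
    measurableSet_le measurable_const ENNReal.measurable_ofReal
  have h1 : ∫⁻ x in Set.Ioi (0 : ℝ), ENNReal.ofReal (Real.exp (-x)) *
      {h : ℝ | (t : ℝ≥0∞) ≤ ENNReal.ofReal h}.indicator 1 x =
      ∫⁻ x in Set.Ioi (t : ℝ), ENNReal.ofReal (Real.exp (-x)) := by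
    rw [← lintegral_indicator measurableSet_Ioi, ← lintegral_indicator measurableSet_Ioi]
    refine lintegral_congr_ae ?_
    filter_upwards [Measure.ae_ne volume (0 : ℝ), Measure.ae_ne volume (t : ℝ)] with x hx hx'
    have ht : (0 : ℝ) ≤ t := t.2
    by_cases h0 : 0 < x
    · have hiff : (t : ℝ≥0∞) ≤ ENNReal.ofReal x ↔ (t : ℝ) ≤ x := by
        rw [← ENNReal.ofReal_coe_nnreal, ENNReal.ofReal_le_ofReal_iff h0.le]
      by_cases h1 : (t : ℝ) < x
      · simp [Set.indicator, h0, h1, hiff, h1.le]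
      · have : ¬ (t : ℝ) ≤ x := fun h => h1 (lt_of_le_of_ne h (Ne.symm hx'))
        simp [Set.indicator, h0, h1, hiff, this]
    · have : ¬ (t : ℝ) < x := fun h => h0 (ht.trans_lt h)
      simp [Set.indicator, h0, this]
  rw [← lintegral_indicator_one hm, lintegral_expMeasure_one (measurable_one.indicator hm), h1]
  have := lintegral_exp_neg_mul_Ioi one_pos (t : ℝ)
  simp only [one_mul, div_one] at this
  rw [this, ← ENNReal.ofReal_coe_nnreal, expNeg_ofReal t.coe_nonneg]

lemma lintegral_one_sub_expNeg_expMeasure {a : ℝ} (ha : 0 ≤ a) :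
    ∫⁻ h, (1 - expNeg (ENNReal.ofReal a * ENNReal.ofReal h)) ∂(expMeasure 1) =
      ENNReal.ofReal (a / (1 + a)) := by
  have hm : Measurable fun h : ℝ => expNeg (ENNReal.ofReal a * ENNReal.ofReal h) := by fun_prop
  have h1 : ∫⁻ h, expNeg (ENNReal.ofReal a * ENNReal.ofReal h) ∂(expMeasure 1) =
      ENNReal.ofReal (1 / (1 + a)) := by
    rw [lintegral_expMeasure_one hm]
    have h2 := lintegral_exp_neg_mul_Ioi (a := 1 + a) (by linarith) 0
    rw [mul_zero, neg_zero, Real.exp_zero] at h2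
    rw [← h2]
    refine setLIntegral_congr_fun measurableSet_Ioi fun x hx => ?_
    have hx : 0 < x := hx
    rw [← ENNReal.ofReal_mul ha, expNeg_ofReal (by positivity),
      ← ENNReal.ofReal_mul (Real.exp_pos _).le, ← Real.exp_add]
    ring_nf
  rw [lintegral_sub hm (by rw [h1]; exact ENNReal.ofReal_ne_top)
    (ae_of_all _ fun _ => expNeg_le_one _), h1, lintegral_one, measure_univ, ← ENNReal.ofReal_one,
    ← ENNReal.ofReal_sub _ (by positivity)]
  congr 1
  field_simp
  ring

/-- Integration in polar coordinates of a radial function in the plane. -/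
lemma lintegral_plane_norm {f : ℝ → ℝ} (hf : ∀ r, 0 ≤ f r)
    (hi : IntegrableOn (fun r => r * f r) (Set.Ioi 0)) :
    ∫⁻ x : Plane, ENNReal.ofReal (f ‖x‖) =
      ENNReal.ofReal (2 * Real.pi * ∫ r in Set.Ioi (0 : ℝ), r * f r) := by
  have hd : Module.finrank ℝ Plane = 2 := by simp
  have h1 := (integrable_fun_norm_addHaar (volume : Measure Plane) (f := f)).2
    (by simpa [hd] using hi)
  rw [← ofReal_integral_eq_lintegral_ofReal h1 (ae_of_all _ fun x => hf _),
    integral_fun_norm_addHaar volume f, hd]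
  congr 1
  have : (volume : Measure Plane).real (Metric.ball 0 1) = Real.pi := by
    rw [measureReal_def, EuclideanSpace.volume_ball_fin_two]
    simp [Real.pi_pos.le]
  rw [this]
  simp
  ring

/-- The radial integral behind the Laplace transform of the interference. -/
lemma lintegral_plane_interference {k θ : ℝ} (hk : 0 ≤ k) (hθ : 0 < θ) :
    ∫⁻ x : Plane, ENNReal.ofReal
        (if k ≤ ‖x‖ ^ 2 then θ * k ^ 2 / (‖x‖ ^ 4 + θ * k ^ 2) else 0) =
      ENNReal.ofReal (Real.pi * k * C θ) := by
  rcases hk.eq_or_lt with rfl | hk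
  · simp
  set A : ℝ := √θ * k with hA
  have hsθ : 0 < √θ := Real.sqrt_pos.2 hθ
  have hA0 : 0 < A := mul_pos hsθ hk
  have hA2 : θ * k ^ 2 = A ^ 2 := by rw [hA, mul_pow, Real.sq_sqrt hθ.le]
  -- Antiderivative of the radial integrand, from the substitution `u = r ^ 2 / A`.
  let G : ℝ → ℝ := fun r => A / 2 * Real.arctan (r ^ 2 / A)
  let g : ℝ → ℝ := fun r => r * (θ * k ^ 2 / (r ^ 4 + θ * k ^ 2))
  have hG : ∀ r, HasDerivAt G (g r) r := by
    intro r
    have h := (((hasDerivAt_pow 2 r).div_const A).arctan).const_mul (A / 2)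
    refine h.congr_deriv ?_
    simp only [g, hA2]
    have : 0 < A ^ 2 + r ^ 4 := by positivity
    have : 0 < 1 + (r ^ 2 / A) ^ 2 := by positivity
    norm_num
    field_simp
    ring
  have hg : ∀ r ∈ Set.Ioi (√k), 0 ≤ g r := fun r hr => by
    have : 0 < r := (Real.sqrt_nonneg k).trans_lt hr
    positivity
  have hlim : Tendsto G atTop (𝓝 (A / 2 * (Real.pi / 2))) := by
    have h1 : Tendsto (fun r : ℝ => r ^ 2 / A) atTop atTop :=
      (tendsto_pow_atTop two_ne_zero).atTop_div_const hA0
    exact ((Real.tendsto_arctan_atTop.mono_right nhdsWithin_le_nhds).comp h1).const_mul _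
  have hint := integrableOn_Ioi_deriv_of_nonneg' (fun r _ => hG r) hg hlim
  have hval := integral_Ioi_of_hasDerivAt_of_nonneg' (fun r _ => hG r) hg hlim
  have hEq : ∀ r ∈ Set.Ioi (0 : ℝ), r * (if k ≤ r ^ 2 then θ * k ^ 2 / (r ^ 4 + θ * k ^ 2) else 0)
      = (Set.Ici (√k)).indicator g r := by
    intro r hr
    have hr : 0 < r := hr
    have hiff : k ≤ r ^ 2 ↔ √k ≤ r := (Real.sqrt_le_left hr.le).symm
    by_cases h : √k ≤ r
    · rw [if_pos (hiff.2 h), Set.indicator_of_mem (Set.mem_Ici.2 h)]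
    · rw [if_neg (fun h' => h (hiff.1 h')), Set.indicator_of_notMem (fun h' => h (Set.mem_Ici.1 h')), mul_zero]
  have hsub : Set.Ioi (0 : ℝ) ∩ Set.Ici (√k) = Set.Ici (√k) :=
    Set.inter_eq_right.2 fun r hr => (Real.sqrt_pos.2 hk).trans_le hr
  rw [lintegral_plane_norm
    (f := fun r => if k ≤ r ^ 2 then θ * k ^ 2 / (r ^ 4 + θ * k ^ 2) else 0)]
  · rw [setIntegral_congr_fun measurableSet_Ioi hEq, setIntegral_indicator measurableSet_Ici, hsub,
      integral_Ici_eq_integral_Ioi, hval]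
    congr 1
    have h3 : (√k) ^ 2 / A = (√θ)⁻¹ := by
      rw [Real.sq_sqrt hk.le, hA]; field_simp
    simp only [G, C]
    -- `π / 2 - arctan (1 / √θ) = arctan √θ` produces `C θ`.
    rw [h3, Real.arctan_inv_of_pos hsθ, hA]
    ring
  · intro r
    split_ifs
    · positivity
    · exact le_rfl
  · rw [integrableOn_congr_fun hEq measurableSet_Ioi, IntegrableOn,
      integrable_indicator_iff measurableSet_Ici, IntegrableOn,
      Measure.restrict_restrict measurableSet_Ici, Set.inter_comm, hsub]
    exact (integrableOn_Ici_iff_integrableOn_Ioi).2 hint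

lemma measurable_pathLoss : Measurable fun p : Plane × ℝ => pathLoss p.1 p.2 := by
  unfold pathLoss; fun_prop

lemma pathLoss_eq_ofReal (x : Plane) {s : ℝ} (hs : 0 ≤ s) :
    pathLoss x s = ENNReal.ofReal (s * ‖x‖ ^ 4) := by
  rw [pathLoss, ENNReal.ofReal_mul hs, ENNReal.ofReal_pow (norm_nonneg _)]

lemma rpow_neg_half {s : ℝ} (hs : 0 ≤ s) : s ^ (-(1 / 2 : ℝ)) = (√s)⁻¹ := by
  rw [Real.rpow_neg hs, Real.sqrt_eq_rpow]

/-- The region where the path loss is below a threshold is a disc. -/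
lemma volume_pathLoss_lt {s t : ℝ} (hs : 0 < s) (ht : 0 ≤ t) :
    (volume : Measure Plane) {x | pathLoss x s < ENNReal.ofReal (t ^ 2)} =
      ENNReal.ofReal (Real.pi * t) * ENNReal.ofReal (s ^ (-(1 / 2 : ℝ))) := by
  have hset : {x : Plane | pathLoss x s < ENNReal.ofReal (t ^ 2)} =
      Metric.ball 0 √(t / √s) := by
    ext x
    rw [Set.mem_ofPred_eq, pathLoss_eq_ofReal x hs.le,
      ENNReal.ofReal_lt_ofReal_iff_of_nonneg (by positivity), mem_ball_zero_iff,
      Real.lt_sqrt (norm_nonneg _), lt_div_iff₀ (Real.sqrt_pos.2 hs),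
      ← pow_lt_pow_iff_left₀ (by positivity) ht two_ne_zero (a := ‖x‖ ^ 2 * √s), mul_pow,
      Real.sq_sqrt hs.le]
    ring_nf
  rw [hset, EuclideanSpace.volume_ball_fin_two, ← ENNReal.ofReal_pow (by positivity),
    Real.sq_sqrt (by positivity), rpow_neg_half hs.le, ← ENNReal.ofReal_mul (by positivity)]
  rw [← ENNReal.ofReal_mul (by positivity)]
  congr 1
  ring

end DistInference
namespace DistInference

/-! ### Law of the serving path loss -/

/-- Tail events of the serving path loss are void events; both its measurability and its law follow
from this. -/
lemma le_servingPathLoss_iff {φ : Measure (Plane × ℝ)} {a : ℝ≥0∞} :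
    a ≤ servingPathLoss φ ↔ φ {p | pathLoss p.1 p.2 < a} = 0 := by
  have h : (φ {p | pathLoss p.1 p.2 < a} = 0) ↔ ∀ᵐ p ∂φ, a ≤ pathLoss p.1 p.2 := by
    rw [ae_iff]; simp only [not_le]
  rw [h]
  constructor
  · intro ha
    filter_upwards [ae_essInf_le (μ := φ) (f := fun p : Plane × ℝ => pathLoss p.1 p.2)] with p hp
    exact ha.trans hp
  · intro ha
    exact le_essInf_of_ae_le a ha

lemma measurableSet_pathLoss_lt (a : ℝ≥0∞) :
    MeasurableSet {p : Plane × ℝ | pathLoss p.1 p.2 < a} :=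
  measurableSet_lt measurable_pathLoss measurable_const

lemma measurable_servingPathLoss : Measurable servingPathLoss := by
  refine measurable_of_Ici fun a => ?_
  have : servingPathLoss ⁻¹' Set.Ici a =
      (fun φ : Measure (Plane × ℝ) => φ {p | pathLoss p.1 p.2 < a}) ⁻¹' {0} := by
    ext φ; exact le_servingPathLoss_iff
  rw [this]
  exact Measure.measurable_coe (measurableSet_pathLoss_lt a) (measurableSet_singleton 0)

variable {σ : Measure ℝ} {lam : ℝ}

/-- For each shadowing value the region is a disc of area proportional to `t`. Linearity in `t` is
what makes the root of the serving path loss exponential. -/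
lemma apIntensity_pathLoss_lt [IsProbabilityMeasure σ] (hσ_pos : ∀ᵐ s ∂σ, 0 < s) {t : ℝ}
    (ht : 0 ≤ t) :
    apIntensity lam σ {p | pathLoss p.1 p.2 < ENNReal.ofReal (t ^ 2)} =
      ENNReal.ofReal lam * (ENNReal.ofReal (Real.pi * t) *
        ∫⁻ s, ENNReal.ofReal (s ^ (-(1 / 2 : ℝ))) ∂σ) := by
  rw [apIntensity, Measure.prod_apply_symm (measurableSet_pathLoss_lt _),
    ← lintegral_const_mul _ (by fun_prop), ← lintegral_const_mul _ (by fun_prop)]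
  refine lintegral_congr_ae ?_
  filter_upwards [hσ_pos] with s hs
  rw [Measure.smul_apply, smul_eq_mul, ← volume_pathLoss_lt hs ht]
  rfl

lemma lintegral_rpow_ne_zero [IsProbabilityMeasure σ] (hσ_pos : ∀ᵐ s ∂σ, 0 < s) :
    ∫⁻ s, ENNReal.ofReal (s ^ (-(1 / 2 : ℝ))) ∂σ ≠ 0 := by
  intro h
  rw [lintegral_eq_zero_iff (by fun_prop)] at h
  have : ∀ᵐ s ∂σ, False := by
    filter_upwards [h, hσ_pos] with s h0 hs
    exact (ENNReal.ofReal_pos.2 (Real.rpow_pos_of_pos hs _)).ne' h0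
  exact this.exists.elim fun _ h => h

variable {Ω : Type*} [MeasurableSpace Ω] {P : Measure Ω} {Φ : Ω → Measure (Plane × ℝ)}

/-- Tail of the distribution of the path loss to the serving AP. -/
lemma measure_le_servingPathLoss [IsProbabilityMeasure σ] (hlam : 0 < lam)
    (hσ_pos : ∀ᵐ s ∂σ, 0 < s)
    (hσ_fin : ∫⁻ s, ENNReal.ofReal (s ^ (-(1 / 2 : ℝ))) ∂σ ≠ ⊤)
    (hΦ : IsPoissonProcess Φ (apIntensity lam σ) P) {t : ℝ} (ht : 0 ≤ t) :
    (P.map fun ω => servingPathLoss (Φ ω)) (Set.Ici (ENNReal.ofReal (t ^ 2))) =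
      ENNReal.ofReal (Real.exp (-(lam * Real.pi *
        (∫⁻ s, ENNReal.ofReal (s ^ (-(1 / 2 : ℝ))) ∂σ).toReal * t))) := by
  set K := ∫⁻ s, ENNReal.ofReal (s ^ (-(1 / 2 : ℝ))) ∂σ with hK
  have hval := apIntensity_pathLoss_lt (lam := lam) hσ_pos ht
  rw [← hK] at hval
  have hval' : apIntensity lam σ {p | pathLoss p.1 p.2 < ENNReal.ofReal (t ^ 2)} =
      ENNReal.ofReal (lam * Real.pi * K.toReal * t) := by
    rw [hval, ← ENNReal.ofReal_toReal hσ_fin, ← ENNReal.ofReal_mul (by positivity),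
      ← ENNReal.ofReal_mul hlam.le, ENNReal.ofReal_toReal hσ_fin]
    ring_nf
  have hmeas : Measurable fun ω => servingPathLoss (Φ ω) :=
    measurable_servingPathLoss.comp hΦ.measurable
  rw [Measure.map_apply hmeas measurableSet_Ici,
    ← expNeg_ofReal (by positivity), ← hval',
    ← hΦ.measure_apply_eq_zero (measurableSet_pathLoss_lt _) (by rw [hval']; simp)]
  congr 1
  ext ω
  exact le_servingPathLoss_iff

/-- The exponential tail tends to `0`. Needed because `toReal` would send the value `⊤` to `0`. -/
lemma servingPathLoss_ae_ne_top [IsProbabilityMeasure σ] (hlam : 0 < lam)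
    (hσ_pos : ∀ᵐ s ∂σ, 0 < s)
    (hσ_fin : ∫⁻ s, ENNReal.ofReal (s ^ (-(1 / 2 : ℝ))) ∂σ ≠ ⊤)
    (hΦ : IsPoissonProcess Φ (apIntensity lam σ) P) :
    ∀ᵐ l ∂(P.map fun ω => servingPathLoss (Φ ω)), l ≠ ⊤ := by
  set K := ∫⁻ s, ENNReal.ofReal (s ^ (-(1 / 2 : ℝ))) ∂σ with hK
  have ha : 0 < lam * Real.pi * K.toReal := by
    have := ENNReal.toReal_pos (lintegral_rpow_ne_zero hσ_pos) hσ_fin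
    positivity
  have hlim : Tendsto (fun t : ℝ => ENNReal.ofReal (Real.exp (-(lam * Real.pi * K.toReal * t))))
      atTop (𝓝 0) := by
    rw [← ENNReal.ofReal_zero]
    refine ENNReal.tendsto_ofReal (Real.tendsto_exp_neg_atTop_nhds_zero.comp ?_)
    exact tendsto_id.const_mul_atTop ha
  rw [ae_iff]
  refine le_antisymm (ge_of_tendsto hlim ?_) zero_le
  filter_upwards [eventually_ge_atTop 0] with t ht
  rw [← measure_le_servingPathLoss hlam hσ_pos hσ_fin hΦ ht]
  refine measure_mono fun l hl => ?_
  have : l = ⊤ := by simpa using hl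
  simp [this]

/-- The path loss to the serving AP has a square root with exponential distribution. -/
lemma lintegral_sqrt_servingPathLoss [IsProbabilityMeasure σ] (hlam : 0 < lam)
    (hσ_pos : ∀ᵐ s ∂σ, 0 < s)
    (hσ_fin : ∫⁻ s, ENNReal.ofReal (s ^ (-(1 / 2 : ℝ))) ∂σ ≠ ⊤)
    (hΦ : IsPoissonProcess Φ (apIntensity lam σ) P) :
    ∫⁻ l, ENNReal.ofReal √l.toReal ∂(P.map fun ω => servingPathLoss (Φ ω)) =
      ENNReal.ofReal (1 / (lam * Real.pi *
        (∫⁻ s, ENNReal.ofReal (s ^ (-(1 / 2 : ℝ))) ∂σ).toReal)) := by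
  have htail := fun t ht => measure_le_servingPathLoss hlam hσ_pos hσ_fin hΦ (t := t) ht
  have htop := servingPathLoss_ae_ne_top hlam hσ_pos hσ_fin hΦ
  set K := ∫⁻ s, ENNReal.ofReal (s ^ (-(1 / 2 : ℝ))) ∂σ with hK
  have ha : 0 < lam * Real.pi * K.toReal := by
    have := ENNReal.toReal_pos (lintegral_rpow_ne_zero hσ_pos) hσ_fin
    positivity
  -- Layer-cake formula: the mean is the integral of the tail.
  rw [lintegral_eq_lintegral_meas_le _ (ae_of_all _ fun l => Real.sqrt_nonneg _)
    (by fun_prop)]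
  have h := lintegral_exp_neg_mul_Ioi ha 0
  rw [mul_zero, neg_zero, Real.exp_zero] at h
  rw [← h]
  refine setLIntegral_congr_fun measurableSet_Ioi fun t ht => ?_
  have ht : 0 < t := ht
  rw [← htail t ht.le]
  refine measure_congr ?_
  filter_upwards [htop] with l hl
  refine propext ?_
  change t ≤ √l.toReal ↔ ENNReal.ofReal (t ^ 2) ≤ l
  rw [Real.le_sqrt' ht, ENNReal.ofReal_le_iff_le_toReal hl]

/-! ### Laplace transform of the interference -/

/-- Contribution to the interference of an interferer. -/
lemma lintegral_fading_plane {s θ : ℝ} {l : ℝ≥0∞} (hs : 0 < s) (hθ : 0 < θ) (hl : l ≠ ⊤)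
    (hlam : 0 ≤ lam) :
    ∫⁻ h, ∫⁻ x : Plane, {x : Plane | l ≤ pathLoss x s}.indicator
        (fun x => 1 - expNeg (ENNReal.ofReal θ * (l * ENNReal.ofReal h / pathLoss x s))) x
        ∂(ENNReal.ofReal lam • volume) ∂(expMeasure 1) =
      ENNReal.ofReal (lam * Real.pi * C θ) * ENNReal.ofReal √l.toReal *
        ENNReal.ofReal (s ^ (-(1 / 2 : ℝ))) := by
  have hms : MeasurableSet {z : ℝ × Plane | l ≤ pathLoss z.2 s} :=
    measurableSet_le measurable_const (by unfold pathLoss; fun_prop)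
  have hm : Measurable fun z : ℝ × Plane => {z : ℝ × Plane | l ≤ pathLoss z.2 s}.indicator
      (fun z => 1 - expNeg (ENNReal.ofReal θ * (l * ENNReal.ofReal z.1 / pathLoss z.2 s))) z := by
    refine Measurable.indicator ?_ hms
    unfold pathLoss
    fun_prop
  have hC : 0 ≤ C θ := mul_nonneg (Real.sqrt_nonneg _) (Real.arctan_nonneg.2 (Real.sqrt_nonneg _))
  -- Integrating the fading first leaves a rational radial function.
  have hswap := lintegral_lintegral_swap (μ := expMeasure 1) (ν := (volume : Measure Plane))
    (f := fun h x => {x : Plane | l ≤ pathLoss x s}.indicator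
        (fun x => 1 - expNeg (ENNReal.ofReal θ * (l * ENNReal.ofReal h / pathLoss x s))) x)
    hm.aemeasurable
  simp only [lintegral_smul_measure, smul_eq_mul]
  rw [lintegral_const_mul' _ _ ENNReal.ofReal_ne_top, hswap]
  have hinner : ∀ᵐ x : Plane, ∫⁻ h, {x : Plane | l ≤ pathLoss x s}.indicator
        (fun x => 1 - expNeg (ENNReal.ofReal θ * (l * ENNReal.ofReal h / pathLoss x s))) x
        ∂(expMeasure 1) = ENNReal.ofReal (if √l.toReal / √s ≤ ‖x‖ ^ 2 then
          θ * (√l.toReal / √s) ^ 2 / (‖x‖ ^ 4 + θ * (√l.toReal / √s) ^ 2) else 0) := by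
    filter_upwards [Measure.ae_ne volume (0 : Plane)] with x hx
    have hx0 : 0 < ‖x‖ := norm_pos_iff.2 hx
    -- With `k = √(l / s)` the association constraint reads `k ≤ ‖x‖ ^ 2`, as in
    -- `lintegral_plane_interference`.
    have hk2 : (√l.toReal / √s) ^ 2 = l.toReal / s := by
      rw [div_pow, Real.sq_sqrt hs.le, Real.sq_sqrt ENNReal.toReal_nonneg]
    have hiff : l ≤ pathLoss x s ↔ √l.toReal / √s ≤ ‖x‖ ^ 2 := by
      rw [pathLoss_eq_ofReal x hs.le, ENNReal.le_ofReal_iff_toReal_le hl (by positivity),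
        ← pow_le_pow_iff_left₀ (by positivity) (by positivity) two_ne_zero
          (a := √l.toReal / √s), hk2, div_le_iff₀ hs]
      ring_nf
    by_cases h : √l.toReal / √s ≤ ‖x‖ ^ 2
    · rw [if_pos h, hk2]
      have : ∀ h : ℝ, ENNReal.ofReal θ * (l * ENNReal.ofReal h / pathLoss x s) =
          ENNReal.ofReal (θ * l.toReal / (s * ‖x‖ ^ 4)) * ENNReal.ofReal h := by
        intro h
        rw [pathLoss_eq_ofReal x hs.le, ENNReal.ofReal_div_of_pos (by positivity),
          ENNReal.ofReal_mul hθ.le, ENNReal.ofReal_toReal hl]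
        simp only [div_eq_mul_inv]
        ring
      have hx' : x ∈ {x : Plane | l ≤ pathLoss x s} := hiff.2 h
      rw [lintegral_congr fun h => (Set.indicator_of_mem hx' _).trans
        (congrArg (fun z => 1 - expNeg z) (this h)), lintegral_one_sub_expNeg_expMeasure (by positivity)]
      congr 1
      field_simp
    · rw [if_neg h, ENNReal.ofReal_zero]
      have hx' : x ∉ {x : Plane | l ≤ pathLoss x s} := fun h' => h (hiff.1 h')
      rw [lintegral_congr fun h => Set.indicator_of_notMem hx' _, lintegral_zero]
  rw [lintegral_congr_ae hinner, lintegral_plane_interference (by positivity) hθ,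
    rpow_neg_half hs.le, ← ENNReal.ofReal_mul hlam, ← ENNReal.ofReal_mul (by positivity),
    ← ENNReal.ofReal_mul (by positivity)]
  congr 1
  ring

lemma measurable_interference_kernel :
    Measurable fun p : Interferer =>
      p.2.2.1 * ENNReal.ofReal p.2.2.2 / pathLoss p.1 p.2.1 := by
  unfold pathLoss; fun_prop

/-- The fading and planar integral is proportional to `√l * s ^ (-1/2)`, so the averages over the
two remaining marks separate. -/
lemma lintegral_interfererIntensity [IsProbabilityMeasure σ] {ν : Measure ℝ≥0∞}
    [IsProbabilityMeasure ν] (hlam : 0 ≤ lam) (hσ_pos : ∀ᵐ s ∂σ, 0 < s)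
    (hν : ∀ᵐ l ∂ν, l ≠ ⊤) {θ : ℝ} (hθ : 0 < θ) :
    ∫⁻ p, (1 - expNeg (ENNReal.ofReal θ *
        (p.2.2.1 * ENNReal.ofReal p.2.2.2 / pathLoss p.1 p.2.1)))
        ∂(interfererIntensity lam σ ν) =
      ENNReal.ofReal (lam * Real.pi * C θ) * (∫⁻ l, ENNReal.ofReal √l.toReal ∂ν) *
        ∫⁻ s, ENNReal.ofReal (s ^ (-(1 / 2 : ℝ))) ∂σ := by
  have hset : MeasurableSet {p : Interferer | p.2.2.1 ≤ pathLoss p.1 p.2.1} :=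
    measurableSet_le (by fun_prop) (by unfold pathLoss; fun_prop)
  have hF : Measurable ({p : Interferer | p.2.2.1 ≤ pathLoss p.1 p.2.1}.indicator
      fun p => 1 - expNeg (ENNReal.ofReal θ *
        (p.2.2.1 * ENNReal.ofReal p.2.2.2 / pathLoss p.1 p.2.1))) := by
    refine Measurable.indicator (measurable_const.sub (measurable_expNeg.comp ?_)) hset
    exact measurable_interference_kernel.const_mul _
  rw [interfererIntensity, ← lintegral_indicator hset, lintegral_prod_symm _ hF.aemeasurable,
    lintegral_prod _ hF.lintegral_prod_left'.aemeasurable]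
  have hinner : ∀ᵐ s ∂σ, ∫⁻ z : ℝ≥0∞ × ℝ, ∫⁻ x,
      {p : Interferer | p.2.2.1 ≤ pathLoss p.1 p.2.1}.indicator
        (fun p => 1 - expNeg (ENNReal.ofReal θ *
          (p.2.2.1 * ENNReal.ofReal p.2.2.2 / pathLoss p.1 p.2.1))) (x, s, z)
        ∂(ENNReal.ofReal lam • (volume : Measure Plane)) ∂(ν.prod (expMeasure 1)) =
      ENNReal.ofReal (lam * Real.pi * C θ) * (∫⁻ l, ENNReal.ofReal √l.toReal ∂ν) *
        ENNReal.ofReal (s ^ (-(1 / 2 : ℝ))) := by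
    filter_upwards [hσ_pos] with s hs
    have hFs := (hF.lintegral_prod_left' (μ := ENNReal.ofReal lam • (volume : Measure Plane))).comp
      (measurable_prodMk_left (x := s))
    refine (lintegral_prod _ ?_).trans ?_
    · exact hFs.aemeasurable
    rw [← lintegral_const_mul _ (by fun_prop), ← lintegral_mul_const _ (by fun_prop)]
    refine lintegral_congr_ae ?_
    filter_upwards [hν] with l hl
    exact lintegral_fading_plane hs hθ hl hlam
  rw [lintegral_congr_ae hinner, lintegral_const_mul _ (by fun_prop)]

/-- Laplace transform of the normalized interference. -/
theorem laplace_interference [IsProbabilityMeasure P] [IsProbabilityMeasure σ] (hlam : 0 < lam)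
    (hσ_pos : ∀ᵐ s ∂σ, 0 < s)
    (hσ_fin : ∫⁻ s, ENNReal.ofReal (s ^ (-(1 / 2 : ℝ))) ∂σ ≠ ⊤)
    {H : Ω → ℝ} {Ψ : Ω → Measure Interferer} (hmodel : IsUplinkModel P lam σ Φ H Ψ)
    {θ : ℝ} (hθ : 0 < θ) :
    ∫⁻ ω, expNeg (ENNReal.ofReal θ * interference (Ψ ω)) ∂P =
      ENNReal.ofReal (Real.exp (-C θ)) := by
  have hν : IsProbabilityMeasure (P.map fun ω => servingPathLoss (Φ ω)) :=
    Measure.isProbabilityMeasure_map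
      (measurable_servingPathLoss.comp hmodel.aps.measurable).aemeasurable
  have hsf : SigmaFinite (interfererIntensity lam σ (P.map fun ω => servingPathLoss (Φ ω))) := by
    have : SigmaFinite (ENNReal.ofReal lam • (volume : Measure Plane)) :=
      inferInstanceAs (SigmaFinite (lam.toNNReal • (volume : Measure Plane)))
    unfold interfererIntensity
    infer_instance
  have hk := measurable_interference_kernel
  have hC : 0 ≤ C θ := mul_nonneg (Real.sqrt_nonneg _) (Real.arctan_nonneg.2 (Real.sqrt_nonneg _))
  simp only [interference, ← lintegral_const_mul _ hk]
  rw [hmodel.interferers.laplace (hk.const_mul _), lintegral_interfererIntensity hlam.le hσ_pos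
    (servingPathLoss_ae_ne_top hlam hσ_pos hσ_fin hmodel.aps) hθ,
    lintegral_sqrt_servingPathLoss hlam hσ_pos hσ_fin hmodel.aps]
  have hK := ENNReal.toReal_pos (lintegral_rpow_ne_zero hσ_pos) hσ_fin
  set K := ∫⁻ s, ENNReal.ofReal (s ^ (-(1 / 2 : ℝ))) ∂σ
  rw [← expNeg_ofReal hC]
  congr 1
  -- The moment `K` here and the mean `1 / (lam * π * K)` of the root path loss cancel: neither the
  -- density nor the shadowing law survives.
  nth_rw 2 [← ENNReal.ofReal_toReal hσ_fin]
  rw [← ENNReal.ofReal_mul (by positivity), ← ENNReal.ofReal_mul (by positivity)]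
  congr 1
  field_simp

/-- Probability that the signal-to-interference ratio is at least `θ`. -/
theorem measure_interference_le_fading [IsProbabilityMeasure P] [IsProbabilityMeasure σ]
    (hlam : 0 < lam) (hσ_pos : ∀ᵐ s ∂σ, 0 < s)
    (hσ_fin : ∫⁻ s, ENNReal.ofReal (s ^ (-(1 / 2 : ℝ))) ∂σ ≠ ⊤)
    {H : Ω → ℝ} {Ψ : Ω → Measure Interferer} (hmodel : IsUplinkModel P lam σ Φ H Ψ)
    {θ : ℝ} (hθ : 0 < θ) :
    P {ω | ENNReal.ofReal θ * interference (Ψ ω) ≤ ENNReal.ofReal (H ω)} =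
      ENNReal.ofReal (Real.exp (-C θ)) := by
  have hI : Measurable interference := Measure.measurable_lintegral measurable_interference_kernel
  have hIΨ : Measurable fun ω => interference (Ψ ω) := hI.comp hmodel.interferers.measurable
  have hH := hmodel.fading.aemeasurable
  have hind : IndepFun H (fun ω => interference (Ψ ω)) P := hmodel.indep.comp measurable_id hI
  have hs : MeasurableSet {z : ℝ × ℝ≥0∞ | ENNReal.ofReal θ * z.2 ≤ ENNReal.ofReal z.1} :=
    measurableSet_le (by fun_prop) (by fun_prop)
  have hmap := (indepFun_iff_map_prod_eq_prod_map_map hH hIΨ.aemeasurable).1 hind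
  rw [hmodel.fading.map_eq] at hmap
  have hpre : {ω | ENNReal.ofReal θ * interference (Ψ ω) ≤ ENNReal.ofReal (H ω)} =
      (fun ω => (H ω, interference (Ψ ω))) ⁻¹'
        {z : ℝ × ℝ≥0∞ | ENNReal.ofReal θ * z.2 ≤ ENNReal.ofReal z.1} := rfl
  rw [hpre, ← Measure.map_apply_of_aemeasurable (hH.prodMk hIΨ.aemeasurable) hs, hmap,
    Measure.prod_apply_symm hs, ← laplace_interference hlam hσ_pos hσ_fin hmodel hθ]
  -- By independence the joint law is a product, so the fading is integrated out at fixed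
  -- interference `i`.
  have h : ∀ i : ℝ≥0∞, expMeasure 1 ((fun x => (x, i)) ⁻¹'
      {z : ℝ × ℝ≥0∞ | ENNReal.ofReal θ * z.2 ≤ ENNReal.ofReal z.1}) =
      expNeg (ENNReal.ofReal θ * i) := fun i =>
    expMeasure_one_le_ofReal (ENNReal.ofReal θ * i)
  simp only [h]
  rw [lintegral_map (by fun_prop) hIΨ]

end DistInference
namespace DistInference

/-! ### From the delay budget to the SIR threshold -/

lemma Params.load_pos (S : Params) : 0 < S.load := by
  have := S.lam_pos
  have := S.lamU_pos
  unfold Params.load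
  positivity

lemma Params.rmin_pos (S : Params) : 0 < S.rmin :=
  div_pos S.q_pos (mul_pos S.b_pos (sub_pos.2 S.δc_lt_δt))

lemma T_pos {t : ℝ} (ht : 0 < t) : 0 < T t :=
  sub_pos.2 (Real.one_lt_rpow one_lt_two ht)

lemma C_pos {x : ℝ} (hx : 0 < x) : 0 < C x :=
  mul_pos (Real.sqrt_pos.2 hx) (Real.arctan_pos.2 (Real.sqrt_pos.2 hx))

/-- `log2` is clipped to `0` below `y = 1`; positivity of `t` keeps the threshold out of the clipped
range. -/
lemma ofReal_le_log2_iff {t : ℝ} (ht : 0 < t) (y : ℝ≥0∞) :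
    ENNReal.ofReal t ≤ log2 y ↔ ENNReal.ofReal (2 ^ t) ≤ y := by
  have hl : 0 < Real.log 2 := Real.log_pos one_lt_two
  have h2 : (2 : ℝ) ^ t = Real.exp (t * Real.log 2) := by
    rw [Real.rpow_def_of_pos two_pos, mul_comm]
  rw [log2, ENNReal.le_div_iff_mul_le (Or.inl (by simpa using hl))
    (Or.inl ENNReal.ofReal_ne_top), ← ENNReal.ofReal_mul ht.le, h2, ← EReal.exp_coe]
  nth_rw 2 [← ENNReal.exp_log y]
  rw [EReal.exp_le_exp_iff]
  have hpos : 0 < t * Real.log 2 := mul_pos ht hl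
  constructor
  · intro h
    have hy : 0 ≤ y.log := by
      by_contra hneg
      rw [EReal.toENNReal_of_nonpos (not_le.1 hneg).le] at h
      exact absurd h (by simpa using hpos)
    have h' := EReal.coe_ennreal_le_coe_ennreal_iff.2 h
    rwa [EReal.coe_toENNReal hy, EReal.coe_ennreal_ofReal, max_eq_left hpos.le] at h'
  · intro h
    have := EReal.toENNReal_le_toENNReal h
    rwa [EReal.toENNReal_of_ne_top (EReal.coe_ne_top _), EReal.toReal_coe] at this

lemma cloudDelay_le_iff (S : Params) (r : ℝ≥0∞) :
    cloudDelay S r r ≤ ENNReal.ofReal S.δt ↔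
      ENNReal.ofReal S.q ≤ ENNReal.ofReal (S.δt - S.δc) * r := by
  have hw : 0 < S.δt - S.δc := sub_pos.2 S.δc_lt_δt
  have h1 : ENNReal.ofReal S.q / (2 * r) + ENNReal.ofReal S.q / (2 * r) =
      ENNReal.ofReal S.q / r := by
    rw [ENNReal.div_add_div_same, ← two_mul, ENNReal.mul_div_mul_left _ _ two_ne_zero
      ENNReal.ofNat_ne_top]
  have h2 : ENNReal.ofReal S.δt = ENNReal.ofReal (S.δt - S.δc) + ENNReal.ofReal S.δc := by
    rw [← ENNReal.ofReal_add hw.le S.δc_nonneg, sub_add_cancel]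
  rw [cloudDelay, h1, h2, ENNReal.add_le_add_iff_right ENNReal.ofReal_ne_top,
    ENNReal.div_le_iff_le_mul (Or.inr ENNReal.ofReal_ne_top) (Or.inr (by simpa using hw))]

lemma ofReal_le_mul_uplinkRate_iff (S : Params) (s : ℝ≥0∞) :
    ENNReal.ofReal S.q ≤ ENNReal.ofReal (S.δt - S.δc) * uplinkRate S s ↔
      ENNReal.ofReal (S.load * S.rmin) ≤ log2 (1 + s) := by
  have hw : 0 < S.δt - S.δc := sub_pos.2 S.δc_lt_δt
  have hL := S.load_pos
  have hb := S.b_pos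
  have hc : 0 < (S.δt - S.δc) * (S.b / S.load) := by positivity
  have h : S.load * S.rmin = S.q / ((S.δt - S.δc) * (S.b / S.load)) := by
    unfold Params.rmin; field_simp
  rw [uplinkRate, ← mul_assoc, ← ENNReal.ofReal_mul hw.le, h, ENNReal.ofReal_div_of_pos hc,
    ENNReal.div_le_iff' (by simpa using hc) ENNReal.ofReal_ne_top]

/-- Without `0 < h` this fails for `θ > 0` when the interference vanishes, since `0 / 0 = 0`; hence
the later restriction to the almost sure event `0 < H`. -/
lemma ofReal_le_sinr_iff {θ h : ℝ} (hh : 0 < h) (ψ : Measure Interferer) :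
    ENNReal.ofReal θ ≤ sinr ⊤ h ψ ↔ ENNReal.ofReal θ * interference ψ ≤ ENNReal.ofReal h := by
  rw [sinr, ENNReal.inv_top, zero_add, ENNReal.le_div_iff_mul_le
    (Or.inr (by simpa using hh)) (Or.inr ENNReal.ofReal_ne_top)]

lemma delay_le_iff {Ω : Type*} [MeasurableSpace Ω] (S : Params) (H : Ω → ℝ)
    (Ψ : Ω → Measure Interferer) {ω : Ω} (hω : 0 < H ω) :
    delay S H Ψ ω ≤ ENNReal.ofReal S.δt ↔
      ENNReal.ofReal (T (S.load * S.rmin)) * interference (Ψ ω) ≤ ENNReal.ofReal (H ω) := by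
  have ht := mul_pos S.load_pos S.rmin_pos
  have h2 : ENNReal.ofReal (2 ^ (S.load * S.rmin)) =
      1 + ENNReal.ofReal (T (S.load * S.rmin)) := by
    rw [← ENNReal.ofReal_one, ← ENNReal.ofReal_add zero_le_one (T_pos ht).le, T, add_sub_cancel]
  rw [delay, cloudDelay_le_iff, ofReal_le_mul_uplinkRate_iff, ofReal_le_log2_iff ht, h2,
    ENNReal.add_le_add_iff_left ENNReal.one_ne_top, ofReal_le_sinr_iff hω]

lemma IsUplinkModel.fading_pos {Ω : Type*} [MeasurableSpace Ω] {P : Measure Ω} {lam : ℝ}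
    {σ : Measure ℝ} {Φ : Ω → Measure (Plane × ℝ)} {H : Ω → ℝ} {Ψ : Ω → Measure Interferer}
    (hmodel : IsUplinkModel P lam σ Φ H Ψ) :
    ∀ᵐ ω ∂P, 0 < H ω := by
  have hm : MeasurableSet {h : ℝ | ¬ 0 < h} := measurableSet_Ioi.compl
  rw [ae_iff, hmodel.fading.measure_eq hm, ← lintegral_indicator_one hm,
    lintegral_expMeasure_one (measurable_one.indicator hm)]
  refine setLIntegral_eq_zero measurableSet_Ioi fun x hx => ?_
  have hx : 0 < x := hx
  simp [Set.indicator, hx]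

section Delay

variable {Ω : Type*} [MeasurableSpace Ω] {P : Measure Ω} {S : Params}
  {σ : Measure ℝ} {Φ : Ω → Measure (Plane × ℝ)} {H : Ω → ℝ}
  {Ψ : Ω → Measure Interferer}

lemma delay_le_ae_eq (hmodel : IsUplinkModel P S.lam σ Φ H Ψ) :
    {ω | delay S H Ψ ω ≤ ENNReal.ofReal S.δt} =ᵐ[P]
      {ω | ENNReal.ofReal (T (S.load * S.rmin)) * interference (Ψ ω) ≤
        ENNReal.ofReal (H ω)} := by
  filter_upwards [hmodel.fading_pos] with ω hω
  exact propext (delay_le_iff S H Ψ hω)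

/-- `HasLaw` makes `H` only almost everywhere measurable, so null measurability is what can be
obtained. -/
lemma nullMeasurableSet_delay_le (hmodel : IsUplinkModel P S.lam σ Φ H Ψ) :
    NullMeasurableSet {ω | delay S H Ψ ω ≤ ENNReal.ofReal S.δt} P := by
  refine NullMeasurableSet.congr ?_ (delay_le_ae_eq hmodel).symm
  have hI : Measurable interference := Measure.measurable_lintegral measurable_interference_kernel
  exact nullMeasurableSet_le
    ((hI.comp hmodel.interferers.measurable).const_mul _).aemeasurable
    hmodel.fading.aemeasurable.ennreal_ofReal

/-- Probability that cloud inference meets the delay budget. -/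
theorem measureReal_delay_le [IsProbabilityMeasure P] [IsProbabilityMeasure σ]
    (hσ_pos : ∀ᵐ s ∂σ, 0 < s)
    (hσ_fin : ∫⁻ s, ENNReal.ofReal (s ^ (-(1 / 2 : ℝ))) ∂σ ≠ ⊤)
    (hmodel : IsUplinkModel P S.lam σ Φ H Ψ) :
    P.real {ω | delay S H Ψ ω ≤ ENNReal.ofReal S.δt} =
      Real.exp (-C (T (S.load * S.rmin))) := by
  rw [measureReal_def, measure_congr (delay_le_ae_eq hmodel),
    measure_interference_le_fading S.lam_pos hσ_pos hσ_fin hmodel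
      (T_pos (mul_pos S.load_pos S.rmin_pos)), ENNReal.toReal_ofReal (Real.exp_pos _).le]

theorem avgMSE_delay_eq [IsProbabilityMeasure P] [IsProbabilityMeasure σ]
    (hσ_pos : ∀ᵐ s ∂σ, 0 < s)
    (hσ_fin : ∫⁻ s, ENNReal.ofReal (s ^ (-(1 / 2 : ℝ))) ∂σ ≠ ⊤)
    (hmodel : IsUplinkModel P S.lam σ Φ H Ψ) (mc md : ℝ) :
    avgMSE P (delay S H Ψ) S.δt mc md =
      Real.exp (-C (T (S.load * S.rmin))) * mc +
        (1 - Real.exp (-C (T (S.load * S.rmin)))) * md := by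
  have hA := nullMeasurableSet_delay_le hmodel
  have hc : {ω | ENNReal.ofReal S.δt < delay S H Ψ ω} =
      {ω | delay S H Ψ ω ≤ ENNReal.ofReal S.δt}ᶜ := by
    ext ω; simp
  rw [avgMSE, hc, integral_indicator₀ hA, integral_indicator₀ hA.compl, setIntegral_const,
    setIntegral_const, probReal_compl_eq_one_sub₀ hA, measureReal_delay_le hσ_pos hσ_fin hmodel,
    smul_eq_mul, smul_eq_mul]

end Delay

/-! ### The critical MSE and its attainment -/

lemma criticalMSE_eq {mc : ℝ} (hmc : mc ≠ 0) (mt t : ℝ) :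
    criticalMSE mc mt t =
      (mt - Real.exp (-C (T t)) * mc) / (1 - Real.exp (-C (T t))) := by
  rw [criticalMSE, mul_div_assoc', mul_sub, mul_div_cancel₀ _ hmc, mul_comm mc (Real.exp _)]

lemma exp_neg_C_T_lt_one {t : ℝ} (ht : 0 < t) : Real.exp (-C (T t)) < 1 :=
  Real.exp_lt_one_iff.2 (neg_lt_zero.2 (C_pos (T_pos ht)))

/-- The left side is affine in `md`, and its slope is positive because `t > 0`. -/
lemma le_criticalMSE_iff {mc mt md t : ℝ} (hmc : mc ≠ 0) (ht : 0 < t) :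
    Real.exp (-C (T t)) * mc + (1 - Real.exp (-C (T t))) * md ≤ mt ↔
      md ≤ criticalMSE mc mt t := by
  rw [criticalMSE_eq hmc, le_div_iff₀ (sub_pos.2 (exp_neg_C_T_lt_one ht))]
  constructor <;> intro h <;> linarith

lemma tendsto_C_T_atTop : Tendsto (fun t => C (T t)) atTop atTop := by
  have hT : Tendsto T atTop atTop := by
    have h := (tendsto_rpow_atTop_of_base_gt_one 2 one_lt_two)
    exact tendsto_atTop_add_const_right _ _ h
  have hs : Tendsto (fun t => √(T t)) atTop atTop := Real.tendsto_sqrt_atTop.comp hT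
  have ha : Tendsto (fun t => Real.arctan √(T t)) atTop (𝓝 (Real.pi / 2)) :=
    (Real.tendsto_arctan_atTop.mono_right nhdsWithin_le_nhds).comp hs
  exact hs.atTop_mul_pos (by positivity) ha

lemma tendsto_criticalMSE {mc : ℝ} (hmc : mc ≠ 0) (mt : ℝ) :
    Tendsto (fun t => criticalMSE mc mt t) atTop (𝓝 mt) := by
  have he : Tendsto (fun t => Real.exp (-C (T t))) atTop (𝓝 0) :=
    Real.tendsto_exp_neg_atTop_nhds_zero.comp tendsto_C_T_atTop
  have h := (tendsto_const_nhds (x := mt)).sub (he.mul_const mc) |>.div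
    ((tendsto_const_nhds (x := (1 : ℝ))).sub he) (by norm_num)
  simp only [zero_mul, sub_zero, div_one] at h
  exact h.congr fun t => (criticalMSE_eq hmc mt t).symm

/-- Shifting an inference model by a constant realizes every larger mean squared error. -/
lemma exists_inferenceModel_mse_eq {𝓧 : Type*} [MeasurableSpace 𝓧] {Q : Measure (𝓧 × ℝ)}
    [IsProbabilityMeasure Q] {f : 𝓧 → ℝ} (hf : IsInferenceModel Q f) {m : ℝ}
    (hm : mse Q f ≤ m) : ∃ g, IsInferenceModel Q g ∧ mse Q g = m := by
  set X : 𝓧 × ℝ → ℝ := fun z => z.2 - f z.1 with hX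
  have hX2 : Integrable (fun z => X z ^ 2) Q := hf.2.integrable_sq
  have hX1 : Integrable X Q := hf.2.integrable one_le_two
  set a := ∫ z, X z ∂Q with ha
  have hdisc : 0 ≤ a ^ 2 + (m - mse Q f) := by nlinarith
  -- A root of `c ^ 2 - 2 * a * c = m - mse Q f`, as a shift by `c` changes the MSE by `c ^ 2 - 2 *
  -- a * c`.
  set c := a + √(a ^ 2 + (m - mse Q f)) with hc
  have heq : ∀ z : 𝓧 × ℝ, z.2 - (f z.1 + c) = X z - c := fun z => by simp only [hX]; ring
  refine ⟨fun x => f x + c, ⟨hf.1.add_const c, ?_⟩, ?_⟩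
  · simp only [heq]
    exact hf.2.sub (memLp_const c)
  · have h : ∀ z, (X z - c) ^ 2 = X z ^ 2 - 2 * c * X z + c ^ 2 := fun z => by ring
    simp only [mse, heq, h]
    have hsub : Integrable (fun z => X z ^ 2 - 2 * c * X z) Q := hX2.sub (hX1.const_mul _)
    rw [integral_add hsub (integrable_const _), integral_sub hX2 (hX1.const_mul _), integral_const_mul, integral_const, ← ha,
      probReal_univ, one_smul]
    have hs := Real.sq_sqrt hdisc
    have hmse : ∫ z, X z ^ 2 ∂Q = mse Q f := rfl
    rw [hmse]
    have : √(a ^ 2 + (m - mse Q f)) = c - a := by rw [hc]; ring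
    rw [this] at hs
    linarith

end DistInference

theorem corollary3 {Ω 𝓧 : Type*} [MeasurableSpace Ω] [MeasurableSpace 𝓧]
    (P : Measure Ω) [IsProbabilityMeasure P]
    -- network: parameters, shadowing law, and the random elements of the uplink
    (S : DistInference.Params)
    (σ : Measure ℝ) [IsProbabilityMeasure σ] (hσ_pos : ∀ᵐ s ∂σ, 0 < s)
    (hσ_fin : ∫⁻ s, ENNReal.ofReal (s ^ (-(1 / 2 : ℝ))) ∂σ ≠ ⊤)
    (Φ : Ω → Measure (DistInference.Plane × ℝ)) (H : Ω → ℝ)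
    (Ψ : Ω → Measure DistInference.Interferer)
    (hmodel : DistInference.IsUplinkModel P S.lam σ Φ H Ψ)
    -- data distribution, cloud model, and target MSE
    (Q : Measure (𝓧 × ℝ)) [IsProbabilityMeasure Q]
    (fc : 𝓧 → ℝ) (hfc : DistInference.IsInferenceModel Q fc) (hmc : 0 < DistInference.mse Q fc)
    (mt : ℝ) (hmt : DistInference.mse Q fc ≤ mt) :
    -- an edge model meets the target exactly when its MSE is at most the critical one
    (∀ fd : 𝓧 → ℝ, DistInference.IsInferenceModel Q fd →
      DistInference.mse Q fc ≤ DistInference.mse Q fd →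
      (DistInference.avgMSE P (DistInference.delay S H Ψ) S.δt
          (DistInference.mse Q fc) (DistInference.mse Q fd) ≤ mt ↔
        DistInference.mse Q fd ≤
          DistInference.criticalMSE (DistInference.mse Q fc) mt (S.load * S.rmin))) ∧
    -- and the critical MSE is the largest edge MSE that meets the target
    IsGreatest
      {m : ℝ | ∃ fd : 𝓧 → ℝ, DistInference.IsInferenceModel Q fd ∧ DistInference.mse Q fd = m ∧
        DistInference.mse Q fc ≤ m ∧
        DistInference.avgMSE P (DistInference.delay S H Ψ) S.δt (DistInference.mse Q fc) m ≤ mt}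
      (DistInference.criticalMSE (DistInference.mse Q fc) mt (S.load * S.rmin)) ∧
    -- limit of the critical MSE as the product of load and inference rate grows
    Tendsto (fun t : ℝ => DistInference.criticalMSE (DistInference.mse Q fc) mt t) atTop
      (𝓝 mt) := by
  have ht : 0 < S.load * S.rmin := mul_pos S.load_pos S.rmin_pos
  have hiff : ∀ md : ℝ, DistInference.avgMSE P (DistInference.delay S H Ψ) S.δt
      (DistInference.mse Q fc) md ≤ mt ↔
        md ≤ DistInference.criticalMSE (DistInference.mse Q fc) mt (S.load * S.rmin) := by
    intro md
    rw [DistInference.avgMSE_delay_eq hσ_pos hσ_fin hmodel,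
      DistInference.le_criticalMSE_iff hmc.ne' ht]
  have hge : DistInference.mse Q fc ≤
      DistInference.criticalMSE (DistInference.mse Q fc) mt (S.load * S.rmin) := by
    -- An edge model as good as the cloud gives average MSE `mc ≤ mt`.
    rw [← DistInference.le_criticalMSE_iff hmc.ne' ht]
    linarith
  refine ⟨fun fd _ _ => hiff _, ⟨?_, ?_⟩, DistInference.tendsto_criticalMSE hmc.ne' mt⟩
  · obtain ⟨fd, hfd, hmse⟩ := DistInference.exists_inferenceModel_mse_eq hfc hge
    exact ⟨fd, hfd, hmse, hge, (hiff _).2 le_rfl⟩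
  · rintro m ⟨-, -, -, -, hm⟩
    exact (hiff m).1 hm
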